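/- **Setting.** Let $\mathcal A$ be a unital $C^*$-algebra and let $H_{\mathcal A}=\ell^2(\mathcal A)$ be the standard (right) Hilbert $\mathcal A$-module, i.e. the set of sequences $(a_i)$ in $\mathcal A$ for which $\sum_i a_i^*a_i$ converges in norm, with inner product $\langle x,y\rangle=\sum_i x_i^*y_i$ and norm $\|x\|=\|\langle x,x\rangle\|^{1/2}$. Let $B^a(H_{\mathcal A})$ be the algebra of bounded adjointable operators on $H_{\mathcal A}$, with the operator norm. For $F\in B^a(H_{\mathcal A})$ consider pairs of decompositions $$H_{\mathcal A}=M_1\,\tilde\oplus\, N_1\ \xrightarrow{\ F\ }\ M_2\,\tilde\oplus\, N_2=H_{\mathcal A}\qquad(*)$$ into (topological, not necessarily orthogonal) direct sums of closed submodules such that $F(M_1)\subseteq M_2$, $F(N_1)\subseteq N_2$ and $F|_{M_1}:M_1\to M_2$ is an isomorphism. We write $F\in\mathcal M\Phi_+$ (resp. $F\in\mathcal M\Phi_-$) if there is such a pair with $N_1$ (resp. $N_2$) finitely generated over $\mathcal A$, and $F\in\mathcal M\Phi$ if there is such a pair with both $N_1$ and $N_2$ finitely generated; the latter is called an $\mathcal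 M\Phi$-decomposition of $F$. If $F\in\mathcal M\Phi$, its index is $\operatorname{index}F=[N_1]-[N_2]\in K(\mathcal A)$, computed from any $\mathcal M\Phi$-decomposition of $F$. Here $K(\mathcal A)=K_0(\mathcal A)$ is the Grothendieck group of the monoid of isomorphism classes of finitely generated projective right $\mathcal A$-modules under direct sum; finitely generated $N_1,N_2$ as in $(*)$ are projective. **Corollary 4.3.** Let $f:[0,1]\to B^a(H_{\mathcal A})$ be continuous and assume that $f([0,1])\subseteq\mathcal M\Phi_+\cup\mathcal M\Phi_-$. Then: 1. If $f(0)\in\mathcal M\Phi_+\setminus\mathcal M\Phi$, then $f(1)\in\mathcal M\Phi_+\setminus\mathcal M\Phi$. 2. If $f(0)\in\mathcal M\Phi_-\setminus\mathcal M\Phi$, then $f(1)\in\mathcal M\Phi_-\setminus\mathcal M\Phi$. 3. If $f(0)\in\mathcal M\Phi$, then $f(1)\in\mathcal M\Phi$ and $\operatorname{index}f(0)=\operatorname{index}f(1)$ in $K(\mathcal A)$, whichever $\mathcal M\Phi$-decompositions of $f(0)$ and $f(1)$ are used to compute the two indices. -/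

import Mathlib

universe u

/-! ## The standard Hilbert module `H_A = ℓ²(A)`

All modules are right modules over the unital C⋆-algebra `A`, that is, modules over `Aᵐᵒᵖ`;
the element `x · a` is written `MulOpposite.op a • x`. -/

section SquareSummable

variable {A : Type u} [CStarAlgebra A]

attribute [local instance] CStarAlgebra.spectralOrder CStarAlgebra.spectralOrderedRing

theorem summable_star_mul_self_of_le {x : ℕ → A} {b : ℕ → A} (hb : Summable b)
    (h : ∀ i, star (x i) * x i ≤ b i) : Summable fun i => star (x i) * x i := by
  rw [summable_iff_vanishing_norm] at hb ⊢
  intro ε hε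
  obtain ⟨s, hs⟩ := hb ε hε
  refine ⟨s, fun t ht => lt_of_le_of_lt ?_ (hs t ht)⟩
  exact CStarAlgebra.norm_le_norm_of_nonneg_of_le
    (Finset.sum_nonneg fun i _ => star_mul_self_nonneg (x i))
    (Finset.sum_le_sum fun i _ => h i)

theorem star_add_mul_add_le (a b : A) :
    star (a + b) * (a + b) ≤ 2 • (star a * a) + 2 • (star b * b) := by
  have h : 2 • (star a * a) + 2 • (star b * b) - star (a + b) * (a + b)
      = star (a - b) * (a - b) := by
    simp only [star_add, star_sub]
    noncomm_ring
  rw [← sub_nonneg, h]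
  exact star_mul_self_nonneg _

theorem summable_star_mul_self_add {x y : ℕ → A} (hx : Summable fun i => star (x i) * x i)
    (hy : Summable fun i => star (y i) * y i) :
    Summable fun i => star ((x + y) i) * (x + y) i :=
  summable_star_mul_self_of_le ((hx.const_smul 2).add (hy.const_smul 2))
    fun i => star_add_mul_add_le (x i) (y i)

theorem summable_star_mul {x y : ℕ → A} (hx : Summable fun i => star (x i) * x i)
    (hy : Summable fun i => star (y i) * y i) : Summable fun i => star (x i) * y i := by
  have hsc : ∀ (z : ℂ), Summable fun i => star ((z • y) i) * (z • y) i := fun z => by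
    have := (hy.const_smul (star z * z))
    refine this.congr fun i => ?_
    simp [smul_smul, mul_comm]
  have h1 := summable_star_mul_self_add hx hy
  have h2 := summable_star_mul_self_add hx (hsc Complex.I)
  have h3 := (h1.sub (hx.add hy)).sub ((h2.sub (hx.add hy)).const_smul Complex.I)
  have h4 := h3.const_smul (2⁻¹ : ℂ)
  refine h4.congr fun i => ?_
  simp only [Pi.add_apply, Pi.smul_apply, star_add, star_smul, add_mul, mul_add, smul_mul_assoc,
    mul_smul_comm, smul_add, smul_sub, smul_smul, Complex.star_def, Complex.conj_I]
  match_scalars <;> ring_nf <;> norm_num [Complex.I_sq]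

variable (A)

/-- The sequences `(aᵢ)` in `A` for which `∑ aᵢ⋆ aᵢ` converges in norm, as a right `A`-module.
(The summands are positive, so convergence of the partial sums and unconditional convergence
are the same.) -/
def squareSummable : Submodule Aᵐᵒᵖ (ℕ → A) where
  carrier := {x | Summable fun i => star (x i) * x i}
  add_mem' hx hy := summable_star_mul_self_add hx hy
  zero_mem' := by simp [summable_zero]
  smul_mem' a x hx := by
    have h := (Summable.mul_left (star a.unop) (Summable.mul_right a.unop hx))
    refine h.congr fun i => ?_
    simp [mul_assoc]

/-- The standard Hilbert module `H_A = ℓ²(A)` over `A`. -/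
def StdModule : Type u := ↥(squareSummable A)

end SquareSummable

namespace StdModule

variable {A : Type u} [CStarAlgebra A]

noncomputable instance : AddCommGroup (StdModule A) :=
  inferInstanceAs (AddCommGroup ↥(squareSummable A))
noncomputable instance : Module Aᵐᵒᵖ (StdModule A) :=
  inferInstanceAs (Module Aᵐᵒᵖ ↥(squareSummable A))
noncomputable instance : Module ℂ (StdModule A) :=
  inferInstanceAs (Module ℂ ↥(squareSummable A))
noncomputable instance : IsScalarTower ℂ Aᵐᵒᵖ (StdModule A) :=
  inferInstanceAs (IsScalarTower ℂ Aᵐᵒᵖ ↥(squareSummable A))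

instance : CoeFun (StdModule A) fun _ => ℕ → A := ⟨fun x => x.1⟩

/-- A square summable sequence as an element of `H_A`. -/
def mk (x : ℕ → A) (h : Summable fun i => star (x i) * x i) : StdModule A := ⟨x, h⟩

@[simp] theorem mk_apply (x : ℕ → A) (h) (i : ℕ) : (mk x h) i = x i := rfl

theorem summable (x : StdModule A) : Summable fun i => star (x i) * x i := x.2

@[ext] theorem ext {x y : StdModule A} (h : ∀ i, x i = y i) : x = y := Subtype.ext (funext h)

@[simp] theorem add_apply (x y : StdModule A) (i : ℕ) : (x + y) i = x i + y i := rfl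
@[simp] theorem sub_apply (x y : StdModule A) (i : ℕ) : (x - y) i = x i - y i := rfl
@[simp] theorem zero_apply (i : ℕ) : (0 : StdModule A) i = 0 := rfl
@[simp] theorem smul_apply (z : ℂ) (x : StdModule A) (i : ℕ) : (z • x) i = z • x i := rfl
@[simp] theorem op_smul_apply (a : Aᵐᵒᵖ) (x : StdModule A) (i : ℕ) :
    (a • x) i = x i * a.unop := rfl

/-- The `A`-valued inner product `⟨x, y⟩ = ∑ xᵢ⋆ yᵢ` of `H_A`. -/
noncomputable def innerA (x y : StdModule A) : A := ∑' i, star (x i) * y i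

theorem summable_inner (x y : StdModule A) : Summable fun i => star (x i) * y i :=
  summable_star_mul x.summable y.summable

theorem innerA_add_left (x y z : StdModule A) : innerA (x + y) z = innerA x z + innerA y z := by
  simp only [innerA, add_apply, star_add, add_mul]
  exact (summable_inner x z).tsum_add (summable_inner y z)

theorem innerA_add_right (x y z : StdModule A) : innerA x (y + z) = innerA x y + innerA x z := by
  simp only [innerA, add_apply, mul_add]
  exact (summable_inner x y).tsum_add (summable_inner x z)

theorem innerA_smul_left (c : ℂ) (x y : StdModule A) : innerA (c • x) y = star c • innerA x y := by
  simp only [innerA, smul_apply, star_smul, smul_mul_assoc]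
  exact (summable_inner x y).tsum_const_smul _

theorem innerA_smul_right (c : ℂ) (x y : StdModule A) : innerA x (c • y) = c • innerA x y := by
  simp only [innerA, smul_apply, mul_smul_comm]
  exact (summable_inner x y).tsum_const_smul _

/-- The norm `‖x‖ = ‖⟨x, x⟩‖ ^ (1 / 2)` of `H_A`. -/
noncomputable instance : Norm (StdModule A) := ⟨fun x => √‖innerA x x‖⟩

section order

attribute [local instance] CStarAlgebra.spectralOrder CStarAlgebra.spectralOrderedRing

/-- `H_A` is a Hilbert C⋆-module. -/
noncomputable abbrev cstarModule : CStarModule Aᵐᵒᵖ (StdModule A) where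
  inner x y := MulOpposite.op (innerA x y)
  inner_add_right {x y z} := by
    rw [← MulOpposite.op_add]
    exact congrArg MulOpposite.op (innerA_add_right x y z)
  inner_self_nonneg {x} := by
    rw [← MulOpposite.unop_le_unop]
    exact tsum_nonneg fun i => star_mul_self_nonneg (x i)
  inner_self {x} := by
    rw [MulOpposite.op_eq_zero_iff]
    constructor
    · intro h
      ext i
      have h1 := (hasSum_zero_iff_of_nonneg (fun i => star_mul_self_nonneg (x i))).1
        (show HasSum _ (0 : A) from h ▸ (show HasSum _ (innerA x x) from x.summable.hasSum))
      simpa using congrFun h1 i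
    · rintro rfl
      simp [innerA]
  inner_op_smul_right {a x y} := by
    apply MulOpposite.unop_injective
    simp only [innerA, op_smul_apply, ← mul_assoc, MulOpposite.unop_op, MulOpposite.unop_mul]
    exact (summable_inner x y).tsum_mul_right _
  inner_smul_right_complex {z x y} := by
    rw [← MulOpposite.op_smul]
    exact congrArg MulOpposite.op (innerA_smul_right z x y)
  star_inner x y := by
    apply MulOpposite.unop_injective
    simp only [innerA, MulOpposite.unop_op, MulOpposite.unop_star, tsum_star, star_mul, star_star]
  norm_eq_sqrt_norm_inner_self x := rfl

theorem normedSpaceCore : NormedSpace.Core ℂ (StdModule A) :=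
  letI := cstarModule (A := A)
  CStarModule.normedSpaceCore Aᵐᵒᵖ

end order

noncomputable instance : NormedAddCommGroup (StdModule A) := .ofCore normedSpaceCore
noncomputable instance : NormedSpace ℂ (StdModule A) := .ofCore normedSpaceCore

theorem norm_sq (x : StdModule A) : ‖x‖ ^ 2 = ‖innerA x x‖ :=
  Real.sq_sqrt (norm_nonneg _)

theorem norm_op_smul_le (a : A) (x : StdModule A) : ‖MulOpposite.op a • x‖ ≤ ‖x‖ * ‖a‖ := by
  refine (pow_le_pow_iff_left₀ (norm_nonneg _) (by positivity) two_ne_zero).1 ?_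
  have h : innerA (MulOpposite.op a • x) (MulOpposite.op a • x) = star a * innerA x x * a := by
    simp only [innerA, op_smul_apply, MulOpposite.unop_op, star_mul]
    rw [← x.summable.tsum_mul_left, ← (x.summable.mul_left (star a)).tsum_mul_right]
    simp only [mul_assoc]
  rw [norm_sq, h, mul_pow, norm_sq]
  calc ‖star a * innerA x x * a‖ ≤ ‖star a‖ * ‖innerA x x‖ * ‖a‖ := norm_mul₃_le
    _ = ‖innerA x x‖ * ‖a‖ ^ 2 := by rw [norm_star]; ring

section order

attribute [local instance] CStarAlgebra.spectralOrder CStarAlgebra.spectralOrderedRing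

theorem norm_sum_le (x : StdModule A) (t : Finset ℕ) :
    ‖∑ i ∈ t, star (x i) * x i‖ ≤ ‖x‖ ^ 2 := by
  rw [norm_sq]
  exact CStarAlgebra.norm_le_norm_of_nonneg_of_le
    (Finset.sum_nonneg fun i _ => star_mul_self_nonneg (x i))
    (x.summable.sum_le_tsum t fun i _ => star_mul_self_nonneg (x i))

theorem norm_apply_le (x : StdModule A) (i : ℕ) : ‖x i‖ ≤ ‖x‖ := by
  refine (pow_le_pow_iff_left₀ (norm_nonneg _) (norm_nonneg _) two_ne_zero).1 ?_
  have h := norm_sum_le x {i}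
  rwa [Finset.sum_singleton, CStarRing.norm_star_mul_self, ← sq] at h

theorem norm_le_of_sum_le {x : StdModule A} {r : ℝ} (hr : 0 ≤ r)
    (h : ∀ t : Finset ℕ, ‖∑ i ∈ t, star (x i) * x i‖ ≤ r ^ 2) : ‖x‖ ≤ r := by
  refine (pow_le_pow_iff_left₀ (norm_nonneg _) hr two_ne_zero).1 ?_
  rw [norm_sq]
  exact le_of_tendsto x.summable.hasSum.norm (Filter.Eventually.of_forall h)

instance : CompleteSpace (StdModule A) := by
  refine Metric.complete_of_cauchySeq_tendsto fun x hx => ?_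
  have hc : ∀ i, ∃ a, Filter.Tendsto (fun m => x m i) Filter.atTop (nhds a) := fun i => by
    refine cauchySeq_tendsto_of_complete (Metric.cauchySeq_iff'.2 fun ε hε => ?_)
    obtain ⟨N, hN⟩ := Metric.cauchySeq_iff'.1 hx ε hε
    refine ⟨N, fun n hn => lt_of_le_of_lt ?_ (hN n hn)⟩
    rw [dist_eq_norm, dist_eq_norm, ← sub_apply]
    exact norm_apply_le _ i
  choose y hy using hc
  have key : ∀ ε > 0, ∃ N, ∀ n ≥ N, ∀ t : Finset ℕ,
      ‖∑ i ∈ t, star (x n i - y i) * (x n i - y i)‖ ≤ ε ^ 2 := fun ε hε => by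
    obtain ⟨N, hN⟩ := Metric.cauchySeq_iff.1 hx ε hε
    refine ⟨N, fun n hn t => ?_⟩
    have hlim : Filter.Tendsto
        (fun m => ‖∑ i ∈ t, star (x n i - x m i) * (x n i - x m i)‖) Filter.atTop
        (nhds ‖∑ i ∈ t, star (x n i - y i) * (x n i - y i)‖) :=
      (tendsto_finsetSum _ fun i _ =>
        ((tendsto_const_nhds.sub (hy i)).star.mul (tendsto_const_nhds.sub (hy i)))).norm
    refine le_of_tendsto hlim (Filter.eventually_atTop.2 ⟨N, fun m hm => ?_⟩)
    have h1 := norm_sum_le (x n - x m) t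
    have h2 := hN n hn m hm
    rw [dist_eq_norm] at h2
    exact h1.trans (pow_le_pow_left₀ (norm_nonneg _) h2.le 2)
  have hsum : Summable fun i => star (y i) * y i := by
    rw [summable_iff_vanishing_norm]
    intro ε hε
    obtain ⟨N, hN⟩ := key √(ε / 8) (by positivity)
    obtain ⟨s, hs⟩ := summable_iff_vanishing_norm.1 (x N).summable (ε / 8) (by positivity)
    refine ⟨s, fun t ht => ?_⟩
    have hle : ∑ i ∈ t, star (y i) * y i ≤ 2 • ∑ i ∈ t, star (x N i) * x N i
        + 2 • ∑ i ∈ t, star (x N i - y i) * (x N i - y i) := by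
      rw [Finset.smul_sum, Finset.smul_sum, ← Finset.sum_add_distrib]
      refine Finset.sum_le_sum fun i _ => ?_
      have := star_add_mul_add_le (x N i) (-(x N i - y i))
      rwa [star_neg, neg_mul_neg, neg_sub, add_sub_cancel] at this
    have h1 := CStarAlgebra.norm_le_norm_of_nonneg_of_le
      (Finset.sum_nonneg fun i _ => star_mul_self_nonneg (y i)) hle
    have h2 := hN N le_rfl t
    rw [Real.sq_sqrt (by positivity)] at h2
    have h3 := hs t ht
    have h4 : ∀ a b : A, ‖2 • a + 2 • b‖ ≤ 2 * ‖a‖ + 2 * ‖b‖ := fun a b => by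
      rw [two_nsmul, two_nsmul, two_mul, two_mul]
      exact (norm_add_le _ _).trans (add_le_add (norm_add_le _ _) (norm_add_le _ _))
    linarith [h4 (∑ i ∈ t, star (x N i) * x N i)
      (∑ i ∈ t, star (x N i - y i) * (x N i - y i))]
  refine ⟨mk y hsum, Metric.tendsto_atTop.2 fun ε hε => ?_⟩
  obtain ⟨N, hN⟩ := key (ε / 2) (by positivity)
  refine ⟨N, fun n hn => ?_⟩
  rw [dist_eq_norm]
  have : ‖x n - mk y hsum‖ ≤ ε / 2 := norm_le_of_sum_le (by positivity) (hN n hn)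
  linarith

end order

/-- The coordinates `0, …, m - 1` of an element of `H_A`. -/
def coords (m : ℕ) : StdModule A →ₗ[Aᵐᵒᵖ] (Fin m → Aᵐᵒᵖ) where
  toFun x i := MulOpposite.op (x i)
  map_add' _ _ := rfl
  map_smul' _ _ := rfl

/-- The element of `H_A` with prescribed coordinates `0, …, m - 1`, the others being `0`. -/
def ofCoords (m : ℕ) : (Fin m → Aᵐᵒᵖ) →ₗ[Aᵐᵒᵖ] StdModule A where
  toFun c := mk (fun i => if h : i < m then (c ⟨i, h⟩).unop else 0) <| by
    refine summable_of_ne_finset_zero (s := Finset.range m) fun i hi => ?_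
    simp only [dif_neg (show ¬ i < m by simpa using hi), mul_zero]
  map_add' c d := by
    ext i
    by_cases h : i < m <;> simp [h]
  map_smul' a c := by
    ext i
    by_cases h : i < m <;> simp [h]

theorem ofCoords_apply (m : ℕ) (c : Fin m → Aᵐᵒᵖ) (i : ℕ) :
    (ofCoords m c) i = if h : i < m then (c ⟨i, h⟩).unop else 0 := rfl

theorem coords_apply (m : ℕ) (x : StdModule A) (i : Fin m) :
    coords m x i = MulOpposite.op (x i) := rfl

theorem tendsto_ofCoords_coords (x : StdModule A) :
    Filter.Tendsto (fun m => ofCoords m (coords m x)) Filter.atTop (nhds x) := by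
  rw [tendsto_iff_norm_sub_tendsto_zero]
  have h : ∀ m, ‖ofCoords m (coords m x) - x‖ = √‖∑' i, star (x (i + m)) * x (i + m)‖ := fun m => by
    have e : ∀ i, (ofCoords m (coords m x) - x) i = if i < m then 0 else - x i := fun i => by
      by_cases h : i < m <;> simp [h, ofCoords_apply, coords_apply]
    change √‖innerA _ _‖ = _
    rw [innerA, ← (ofCoords m (coords m x) - x).summable.sum_add_tsum_nat_add m]
    rw [Finset.sum_eq_zero fun i hi => by rw [e, if_pos (by simpa using hi), mul_zero], zero_add]
    simp only [e]
    simp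
  simp only [h]
  have := (tendsto_sum_nat_add fun i => star (x i) * x i).norm.sqrt
  simpa using this

end StdModule

/-! ## Finitely generated closed summands are projective -/

section Projective

variable {A : Type u} [CStarAlgebra A]

theorem isCompl_restrictScalars {M N : Submodule Aᵐᵒᵖ (StdModule A)} (h : IsCompl M N) :
    IsCompl (M.restrictScalars ℂ) (N.restrictScalars ℂ) := by
  refine ⟨Submodule.disjoint_def.2 fun x hM hN => Submodule.disjoint_def.1 h.disjoint x hM hN,
    codisjoint_iff.2 (eq_top_iff.2 fun x _ => ?_)⟩
  obtain ⟨a, ha, b, hb, rfl⟩ := Submodule.mem_sup.1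
    ((codisjoint_iff.1 h.codisjoint).symm ▸ Submodule.mem_top : x ∈ M ⊔ N)
  exact Submodule.add_mem_sup (show a ∈ M.restrictScalars ℂ from ha)
    (show b ∈ N.restrictScalars ℂ from hb)

theorem norm_map_pi_le {n : ℕ} {N : Submodule Aᵐᵒᵖ (StdModule A)}
    (u : (Fin n → Aᵐᵒᵖ) →ₗ[Aᵐᵒᵖ] N) (c : Fin n → Aᵐᵒᵖ) :
    ‖u c‖ ≤ (∑ j, ‖u (Pi.single j 1)‖) * ‖c‖ := by
  have hc : u c = ∑ j, c j • u (Pi.single j 1) := by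
    conv_lhs => rw [pi_eq_sum_univ' c]
    simp [map_sum, Pi.single]
  rw [hc, Finset.sum_mul]
  refine norm_sum_le_of_le _ fun j _ => ?_
  refine (StdModule.norm_op_smul_le (c j).unop (u (Pi.single j 1) : StdModule A)).trans ?_
  exact mul_le_mul_of_nonneg_left (norm_le_pi_norm c j) (norm_nonneg _)

/-- A finitely generated closed submodule of `H_A` which has a closed complement is projective. -/
theorem projective_of_isCompl {M N : Submodule Aᵐᵒᵖ (StdModule A)}
    (hM : IsClosed (M : Set (StdModule A))) (hN : IsClosed (N : Set (StdModule A)))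
    (h : IsCompl M N) (hfg : N.FG) : Module.Projective Aᵐᵒᵖ N := by
  let N' : Submodule ℂ (StdModule A) := N.restrictScalars ℂ
  have : CompleteSpace N' := hN.completeSpace_coe
  -- the projection onto `N` along `M`, which is continuous
  let p : StdModule A →ₗ[Aᵐᵒᵖ] N := Submodule.projectionOnto N M h.symm
  have hp : Continuous p :=
    (Submodule.projectionOntoL N' (M.restrictScalars ℂ)
      (Submodule.IsCompl.isTopCompl_of_isClosed (isCompl_restrictScalars h.symm) hN hM)).continuous
  have hpN : ∀ x : N, p x = x := fun x => Submodule.projectionOnto_apply_left h.symm x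
  -- the compression to `N` of the projection to the first `m` coordinates
  let q : ℕ → N →ₗ[Aᵐᵒᵖ] N := fun m => p ∘ₗ StdModule.ofCoords m ∘ₗ StdModule.coords m ∘ₗ N.subtype
  have hq : ∀ x : N, Filter.Tendsto (fun m => q m x) Filter.atTop (nhds x) := fun x => by
    have := (hp.tendsto (x : StdModule A)).comp (StdModule.tendsto_ofCoords_coords (x : StdModule A))
    rwa [hpN] at this
  -- a bounded surjection from a free module, with preimages of controlled norm
  have : Module.Finite Aᵐᵒᵖ N := Module.Finite.iff_fg.2 hfg
  obtain ⟨n, f, hf⟩ := Module.Finite.exists_fin' Aᵐᵒᵖ N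
  let f' : (Fin n → Aᵐᵒᵖ) →L[ℂ] N' :=
    LinearMap.mkContinuous (f.restrictScalars ℂ) _ (norm_map_pi_le f)
  obtain ⟨C, hC, hpre⟩ := f'.exists_preimage_norm_le hf
  -- for large `m` the compression is close to the identity, hence invertible
  have hlim : Filter.Tendsto
      (fun m => (∑ j, ‖(f - q m ∘ₗ f) (Pi.single j 1)‖) * C) Filter.atTop (nhds 0) := by
    rw [← zero_mul C]
    refine Filter.Tendsto.mul_const C ?_
    rw [← Finset.sum_const_zero (s := (Finset.univ : Finset (Fin n)))]
    refine tendsto_finsetSum _ fun j _ => ?_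
    have := (tendsto_const_nhds (x := f (Pi.single j 1))).sub (hq (f (Pi.single j 1)))
    simpa using this.norm
  obtain ⟨m, hm⟩ := (hlim.eventually_lt_const one_pos).exists
  have hbound : ∀ x : N, ‖x - q m x‖ ≤ (∑ j, ‖(f - q m ∘ₗ f) (Pi.single j 1)‖) * C * ‖x‖ := by
    intro x
    obtain ⟨c, rfl, hc⟩ := hpre x
    refine (norm_map_pi_le (f - q m ∘ₗ f) c).trans ?_
    rw [mul_assoc]
    exact mul_le_mul_of_nonneg_left hc (Finset.sum_nonneg fun _ _ => norm_nonneg _)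
  let L : N' →ₗ[ℂ] N' :=
    { toFun := fun x => (LinearMap.id - q m : N →ₗ[Aᵐᵒᵖ] N) x
      map_add' := fun x y => map_add (LinearMap.id - q m : N →ₗ[Aᵐᵒᵖ] N) x y
      map_smul' := fun z x => (LinearMap.id - q m : N →ₗ[Aᵐᵒᵖ] N).map_smul_of_tower z x }
  let T : N' →L[ℂ] N' := LinearMap.mkContinuous L _ hbound
  have hT : ‖T‖ < 1 := (LinearMap.mkContinuous_norm_le _
    (mul_nonneg (Finset.sum_nonneg fun _ _ => norm_nonneg _) hC.le) _).trans_lt hm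
  have hqT : ∀ x : N, (1 - T) x = q m x := fun x => sub_sub_cancel x (q m x)
  have hunit : IsUnit (1 - T) := (Units.oneSub T hT).isUnit
  have hbij : Function.Bijective (q m) := by
    have h1 : Function.Bijective (1 - T : N' →L[ℂ] N') :=
      (ContinuousLinearEquiv.ofUnit hunit.unit).bijective
    exact (funext hqT : ((1 - T : N' →L[ℂ] N') : N → N) = q m) ▸ h1
  let e := LinearEquiv.ofBijective (q m) hbij
  refine Module.Projective.of_split (StdModule.coords m ∘ₗ N.subtype)
    (e.symm.toLinearMap ∘ₗ p ∘ₗ StdModule.ofCoords m) (LinearMap.ext fun x => ?_)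
  exact e.symm_apply_apply x

end Projective

/-! ## Bounded adjointable operators -/

section Operators

variable (A : Type u) [CStarAlgebra A]

/-- `B^a(H_A)`: the algebra of bounded operators `T` on `H_A` which have an adjoint, that is, an
operator `S` with `⟨T x, y⟩ = ⟨x, S y⟩`. It carries the operator norm. -/
def AdjointableOperators : Subalgebra ℂ (StdModule A →L[ℂ] StdModule A) where
  carrier := {T | ∃ S : StdModule A →L[ℂ] StdModule A,
    ∀ x y, StdModule.innerA (T x) y = StdModule.innerA x (S y)}
  mul_mem' := by
    rintro T T' ⟨S, hS⟩ ⟨S', hS'⟩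
    exact ⟨S' * S, fun x y => by simp [hS, hS']⟩
  add_mem' := by
    rintro T T' ⟨S, hS⟩ ⟨S', hS'⟩
    refine ⟨S + S', fun x y => ?_⟩
    simp [StdModule.innerA_add_left, StdModule.innerA_add_right, hS, hS']
  algebraMap_mem' z := by
    refine ⟨algebraMap ℂ _ (star z), fun x y => ?_⟩
    simp [Algebra.algebraMap_eq_smul_one, StdModule.innerA_smul_left, StdModule.innerA_smul_right]

variable {A}

/-- Adjointable operators are `A`-linear. -/
theorem AdjointableOperators.map_op_smul (T : AdjointableOperators A) (a : Aᵐᵒᵖ)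
    (x : StdModule A) : T.1 (a • x) = a • T.1 x := by
  obtain ⟨S, hS⟩ := T.2
  have hl : ∀ u v : StdModule A,
      StdModule.innerA (a • u) v = star a.unop * StdModule.innerA u v := fun u v => by
    simp only [StdModule.innerA, StdModule.op_smul_apply, star_mul, mul_assoc]
    exact (StdModule.summable_inner u v).tsum_mul_left _
  have h0 : ∀ y, StdModule.innerA (T.1 (a • x) - a • T.1 x) y = 0 := fun y => by
    rw [sub_eq_add_neg, ← neg_one_smul ℂ (a • T.1 x), StdModule.innerA_add_left,
      StdModule.innerA_smul_left, hS, hl, hl, hS]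
    simp
  rw [← sub_eq_zero, ← norm_eq_zero, ← sq_eq_zero_iff, StdModule.norm_sq, h0, norm_zero]

end Operators

/-! ## The group `K(A)` -/

section KGroup

variable (R : Type u) [Ring R]

/-- A finitely generated projective module over `R`. -/
structure FGProjective where
  carrier : Type u
  [addCommGroup : AddCommGroup carrier]
  [module : Module R carrier]
  [finite : Module.Finite R carrier]
  [projective : Module.Projective R carrier]

attribute [instance] FGProjective.addCommGroup FGProjective.module FGProjective.finite
  FGProjective.projective

/-- Isomorphism of finitely generated projective modules. -/
instance FGProjective.setoid : Setoid (FGProjective R) where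
  r P Q := Nonempty (P.carrier ≃ₗ[R] Q.carrier)
  iseqv := ⟨fun _ => ⟨LinearEquiv.refl _ _⟩, fun ⟨e⟩ => ⟨e.symm⟩, fun ⟨e⟩ ⟨e'⟩ => ⟨e.trans e'⟩⟩

/-- The set of isomorphism classes of finitely generated projective `R`-modules. -/
def FGProjectiveClass : Type (u + 1) := Quotient (FGProjective.setoid R)

instance : Zero (FGProjectiveClass R) := ⟨Quotient.mk _ ⟨PUnit.{u + 1}⟩⟩

instance : Add (FGProjectiveClass R) :=
  ⟨Quotient.map₂ (fun P Q => ⟨P.carrier × Q.carrier⟩) fun _ _ ⟨e⟩ _ _ ⟨e'⟩ => ⟨e.prodCongr e'⟩⟩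

/-- Isomorphism classes of finitely generated projective modules form a commutative monoid under
the direct sum. -/
instance : AddCommMonoid (FGProjectiveClass R) where
  add_assoc := by
    rintro ⟨P⟩ ⟨Q⟩ ⟨S⟩
    exact Quotient.sound ⟨LinearEquiv.prodAssoc R _ _ _⟩
  zero_add := by
    rintro ⟨P⟩
    exact Quotient.sound ⟨LinearEquiv.uniqueProd⟩
  add_zero := by
    rintro ⟨P⟩
    exact Quotient.sound ⟨LinearEquiv.prodUnique⟩
  add_comm := by
    rintro ⟨P⟩ ⟨Q⟩
    exact Quotient.sound ⟨LinearEquiv.prodComm R _ _⟩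
  nsmul := nsmulRec

end KGroup

section Index

variable (A : Type u) [CStarAlgebra A]

/-- `K(A) = K₀(A)`: the Grothendieck group of the monoid of isomorphism classes of finitely
generated projective right `A`-modules. -/
abbrev KGroup : Type (u + 1) := Algebra.GrothendieckAddGroup (FGProjectiveClass Aᵐᵒᵖ)

/-- The class in `K(A)` of a finitely generated projective right `A`-module. -/
noncomputable def KGroup.cls (P : Type u) [AddCommGroup P] [Module Aᵐᵒᵖ P]
    [Module.Finite Aᵐᵒᵖ P] [Module.Projective Aᵐᵒᵖ P] : KGroup A :=
  Algebra.GrothendieckAddGroup.of (Quotient.mk _ ⟨P⟩ : FGProjectiveClass Aᵐᵒᵖ)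

variable {A}

/-! ## Semi-Fredholm operators -/

/-- `H_A = M₁ ⊕̃ N₁ ⟶ M₂ ⊕̃ N₂ = H_A` are decompositions into (topological, not necessarily
orthogonal) direct sums of closed submodules with respect to which `F` has a diagonal matrix
`diag(F₁, F₄)` such that `F₁ : M₁ → M₂` is an isomorphism.

An adjointable operator is bounded and `A`-linear, and the submodules are Banach spaces, so `F₁` is
an isomorphism as soon as it is bijective. -/
structure Diagonalizes (F : AdjointableOperators A) (M₁ N₁ M₂ N₂ : Submodule Aᵐᵒᵖ (StdModule A)) :
    Prop where
  isClosed_M₁ : IsClosed (M₁ : Set (StdModule A))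
  isClosed_N₁ : IsClosed (N₁ : Set (StdModule A))
  isClosed_M₂ : IsClosed (M₂ : Set (StdModule A))
  isClosed_N₂ : IsClosed (N₂ : Set (StdModule A))
  isCompl₁ : IsCompl M₁ N₁
  isCompl₂ : IsCompl M₂ N₂
  bijOn : Set.BijOn F.1 M₁ M₂
  mapsTo : Set.MapsTo F.1 N₁ N₂

variable (A)

/-- `MΦ₊(H_A)`: the upper semi-`A`-Fredholm operators. -/
def MPhiPlus : Set (AdjointableOperators A) :=
  {F | ∃ M₁ N₁ M₂ N₂, Diagonalizes F M₁ N₁ M₂ N₂ ∧ N₁.FG}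

/-- `MΦ₋(H_A)`: the lower semi-`A`-Fredholm operators. -/
def MPhiMinus : Set (AdjointableOperators A) :=
  {F | ∃ M₁ N₁ M₂ N₂, Diagonalizes F M₁ N₁ M₂ N₂ ∧ N₂.FG}

/-- `MΦ(H_A)`: the `A`-Fredholm operators. -/
def MPhi : Set (AdjointableOperators A) :=
  {F | ∃ M₁ N₁ M₂ N₂, Diagonalizes F M₁ N₁ M₂ N₂ ∧ N₁.FG ∧ N₂.FG}

variable {A}

/-- An `MΦ`-decomposition for `F`. -/
structure MPhiDecomposition (F : AdjointableOperators A) where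
  (M₁ N₁ M₂ N₂ : Submodule Aᵐᵒᵖ (StdModule A))
  diagonalizes : Diagonalizes F M₁ N₁ M₂ N₂
  fg₁ : N₁.FG
  fg₂ : N₂.FG

theorem mem_MPhi_iff {F : AdjointableOperators A} : F ∈ MPhi A ↔ Nonempty (MPhiDecomposition F) :=
  ⟨fun ⟨M₁, N₁, M₂, N₂, h, h₁, h₂⟩ => ⟨⟨M₁, N₁, M₂, N₂, h, h₁, h₂⟩⟩,
    fun ⟨⟨M₁, N₁, M₂, N₂, h, h₁, h₂⟩⟩ => ⟨M₁, N₁, M₂, N₂, h, h₁, h₂⟩⟩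

/-- The index `[N₁] - [N₂] ∈ K(A)` computed from an `MΦ`-decomposition. -/
noncomputable def MPhiDecomposition.index {F : AdjointableOperators A} (d : MPhiDecomposition F) :
    KGroup A :=
  have : Module.Finite Aᵐᵒᵖ d.N₁ := Module.Finite.iff_fg.2 d.fg₁
  have : Module.Finite Aᵐᵒᵖ d.N₂ := Module.Finite.iff_fg.2 d.fg₂
  have : Module.Projective Aᵐᵒᵖ d.N₁ := projective_of_isCompl d.diagonalizes.isClosed_M₁
    d.diagonalizes.isClosed_N₁ d.diagonalizes.isCompl₁ d.fg₁
  have : Module.Projective Aᵐᵒᵖ d.N₂ := projective_of_isCompl d.diagonalizes.isClosed_M₂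
    d.diagonalizes.isClosed_N₂ d.diagonalizes.isCompl₂ d.fg₂
  KGroup.cls A d.N₁ - KGroup.cls A d.N₂

end Index

/-! The set `MPhiPlus A ∪ MPhiMinus A` is the union of three pairwise disjoint open sets: `MPhi A`,
`MPhiPlus A \ MPhi A` and `MPhiMinus A \ MPhi A`. A path in the union stays in the piece where it
starts, and on `MPhi A` the index is locally constant, hence constant along the path.

Openness comes from `Diagonalizes.eventually_nhds`: an operator near `F` keeps `M₁` and `N₂`, while
`N₁` is replaced by an isomorphic module. This also makes the index locally constant, once it is
known not to depend on the decomposition.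

The rest compares two decompositions of one operator. Each diagonal form reduces `F` to its corner
`N₁ → N₂`, the complementary corner being invertible. The two corners fit into an exact sequence `0
→ N₁ → N₂ × N₁' → N₂' → 0`, which splits when `N₂'` is projective and gives equality of indices
(`nonempty_prod_equiv`). Explicit surjections `N₁ × N₂' → N₂` and `N₂ × N₁' → N₁` transfer finite
generation (`fg_target`, `fg_source`). They show that `MPhiPlus A ∩ MPhiMinus A ⊆ MPhi A`, and that
an operator outside `MPhi A` has no nearby operators in `MPhi A` if it is semi-Fredholm. -/

section Decompositions

variable {A : Type u} [CStarAlgebra A]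

/-- An adjointable operator as an `A`-linear map. -/
noncomputable def AdjointableOperators.toLinearMap (F : AdjointableOperators A) :
    StdModule A →ₗ[Aᵐᵒᵖ] StdModule A where
  toFun := F.1
  map_add' := map_add F.1
  map_smul' := AdjointableOperators.map_op_smul F

/-! ### Algebra of a single decomposition. -/

namespace Diagonalizes

variable {F : AdjointableOperators A} {M₁ N₁ M₂ N₂ M₁' N₁' M₂' N₂' : Submodule Aᵐᵒᵖ (StdModule A)}

theorem exists_add (h : Diagonalizes F M₁ N₁ M₂ N₂) (x : StdModule A) :
    ∃ m ∈ M₁, ∃ n ∈ N₁, m + n = x :=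
  Submodule.mem_sup.1 (h.isCompl₁.sup_eq_top ▸ Submodule.mem_top)

theorem exists_map_add (h : Diagonalizes F M₁ N₁ M₂ N₂) (y : StdModule A) :
    ∃ m ∈ M₁, ∃ n ∈ N₂, F.1 m + n = y := by
  obtain ⟨m', hm', n, hn, rfl⟩ := Submodule.mem_sup.1
    (h.isCompl₂.sup_eq_top ▸ Submodule.mem_top : y ∈ M₂ ⊔ N₂)
  obtain ⟨m, hm, rfl⟩ := h.bijOn.surjOn hm'
  exact ⟨m, hm, n, hn, rfl⟩

theorem eq_zero_of_map_mem (h : Diagonalizes F M₁ N₁ M₂ N₂) {m : StdModule A} (hm : m ∈ M₁)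
    (hFm : F.1 m ∈ N₂) : m = 0 := by
  refine h.bijOn.injOn hm M₁.zero_mem ?_
  rw [map_zero]
  exact Submodule.disjoint_def.1 h.isCompl₂.disjoint _ (h.bijOn.mapsTo hm) hFm

/-- The projection onto `N₁` along `M₁`. -/
noncomputable def projSource (h : Diagonalizes F M₁ N₁ M₂ N₂) : StdModule A →ₗ[Aᵐᵒᵖ] N₁ :=
  Submodule.projectionOnto N₁ M₁ h.isCompl₁.symm

/-- The projection onto `N₂` along `M₂`. -/
noncomputable def projTarget (h : Diagonalizes F M₁ N₁ M₂ N₂) : StdModule A →ₗ[Aᵐᵒᵖ] N₂ :=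
  Submodule.projectionOnto N₂ M₂ h.isCompl₂.symm

theorem projSource_coe (h : Diagonalizes F M₁ N₁ M₂ N₂) (x : N₁) : h.projSource x = x :=
  Submodule.projectionOnto_apply_left h.isCompl₁.symm x

theorem projTarget_coe (h : Diagonalizes F M₁ N₁ M₂ N₂) (x : N₂) : h.projTarget x = x :=
  Submodule.projectionOnto_apply_left h.isCompl₂.symm x

theorem projSource_eq_zero_iff (h : Diagonalizes F M₁ N₁ M₂ N₂) {x : StdModule A} :
    h.projSource x = 0 ↔ x ∈ M₁ :=
  Submodule.projectionOnto_apply_eq_zero_iff h.isCompl₁.symm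

theorem projTarget_eq_zero_iff (h : Diagonalizes F M₁ N₁ M₂ N₂) {x : StdModule A} :
    h.projTarget x = 0 ↔ x ∈ M₂ :=
  Submodule.projectionOnto_apply_eq_zero_iff h.isCompl₂.symm

/-- The restriction of `F` to `N₁ → N₂`. -/
noncomputable def restrict (h : Diagonalizes F M₁ N₁ M₂ N₂) : N₁ →ₗ[Aᵐᵒᵖ] N₂ :=
  (AdjointableOperators.toLinearMap F).restrict h.mapsTo

theorem coe_restrict (h : Diagonalizes F M₁ N₁ M₂ N₂) (x : N₁) :
    (h.restrict x : StdModule A) = F.1 x := rfl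

/-- `F` is diagonal, so it intertwines the two projections; this turns statements about `F` into
statements about its corner. -/
theorem projTarget_map (h : Diagonalizes F M₁ N₁ M₂ N₂) (x : StdModule A) :
    h.projTarget (F.1 x) = h.restrict (h.projSource x) := by
  obtain ⟨m, hm, n, hn, rfl⟩ := h.exists_add x
  rw [map_add, map_add, map_add, h.projSource_eq_zero_iff.2 hm,
    h.projTarget_eq_zero_iff.2 (h.bijOn.mapsTo hm), zero_add, zero_add,
    h.projSource_coe ⟨n, hn⟩, ← h.coe_restrict ⟨n, hn⟩, h.projTarget_coe]

/-- Together with `mapsTo`, this says that `N₁` is determined by `N₂` as its preimage. The perturbed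
decomposition in `eventually_nhds` is built from this description. -/
theorem mem_of_map_mem (h : Diagonalizes F M₁ N₁ M₂ N₂) {x : StdModule A} (hx : F.1 x ∈ N₂) :
    x ∈ N₁ := by
  obtain ⟨m, hm, n, hn, rfl⟩ := h.exists_add x
  have hFm : F.1 m ∈ N₂ := by
    have := N₂.sub_mem hx (h.mapsTo hn)
    rwa [map_add, add_sub_cancel_right] at this
  rw [h.eq_zero_of_map_mem hm hFm, zero_add]
  exact hn

/-! ### Comparison of two decompositions of one operator. -/

/-- If `F` has a decomposition with `N₁` finitely generated and one with `N₂'` finitely generated,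
then `N₂` is finitely generated. -/
theorem fg_target (h : Diagonalizes F M₁ N₁ M₂ N₂) (h' : Diagonalizes F M₁' N₁' M₂' N₂')
    (h₁ : N₁.FG) (h₂ : N₂'.FG) : N₂.FG := by
  have := Module.Finite.iff_fg.2 h₁
  have := Module.Finite.iff_fg.2 h₂
  refine Module.Finite.iff_fg.1 (Module.Finite.of_surjective
    (h.restrict.coprod (h.projTarget ∘ₗ N₂'.subtype)) fun y => ?_)
  -- Projecting `y = F m + n` to `N₂` turns `F m` into the image under the corner of the
  -- `N₁`-component of `m`.
  obtain ⟨m, -, n, hn, hy⟩ := h'.exists_map_add y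
  refine ⟨(h.projSource m, ⟨n, hn⟩), ?_⟩
  rw [LinearMap.coprod_apply, ← h.projTarget_map, LinearMap.comp_apply, ← map_add,
    Submodule.subtype_apply, hy, h.projTarget_coe]

/-- A decomposition provides a left inverse of `F` modulo the projection onto `N₁`. -/
theorem exists_parametrix (h : Diagonalizes F M₁ N₁ M₂ N₂) :
    ∃ G : StdModule A →ₗ[Aᵐᵒᵖ] StdModule A, ∀ x, G (F.1 x) + h.projSource x = x := by
  let e : M₁ ≃ₗ[Aᵐᵒᵖ] M₂ := LinearEquiv.ofBijective ((AdjointableOperators.toLinearMap F).restrict h.bijOn.mapsTo)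
    h.bijOn.bijective
  refine ⟨M₁.subtype ∘ₗ e.symm.toLinearMap ∘ₗ Submodule.projectionOnto M₂ N₂ h.isCompl₂,
    fun x => ?_⟩
  obtain ⟨m, hm, n, hn, rfl⟩ := h.exists_add x
  have he : F.1 m = e ⟨m, hm⟩ := rfl
  have hz : Submodule.projectionOnto M₂ N₂ h.isCompl₂ (F.1 n) = 0 :=
    (Submodule.projectionOnto_apply_eq_zero_iff h.isCompl₂).2 (h.mapsTo hn)
  simp only [LinearMap.comp_apply, map_add, hz, h.projSource_eq_zero_iff.2 hm,
    h.projSource_coe ⟨n, hn⟩, he, Submodule.projectionOnto_apply_left]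
  simp

/-- If `F` has a decomposition with `N₂` finitely generated and one with `N₁'` finitely generated,
then `N₁` is finitely generated. -/
theorem fg_source (h : Diagonalizes F M₁ N₁ M₂ N₂) (h' : Diagonalizes F M₁' N₁' M₂' N₂')
    (h₁ : N₁'.FG) (h₂ : N₂.FG) : N₁.FG := by
  have := Module.Finite.iff_fg.2 h₁
  have := Module.Finite.iff_fg.2 h₂
  obtain ⟨G, hG⟩ := h'.exists_parametrix
  refine Module.Finite.iff_fg.1 (Module.Finite.of_surjective
    ((h.projSource ∘ₗ G ∘ₗ N₂.subtype).coprod (h.projSource ∘ₗ N₁'.subtype)) fun y => ?_)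
  -- This is the identity `y = G (F y) + h'.projSource y`, projected back to `N₁`; here `F y ∈ N₂`
  -- because `y ∈ N₁`.
  refine ⟨(h.restrict y, h'.projSource y), ?_⟩
  simp only [LinearMap.coprod_apply, LinearMap.comp_apply, Submodule.subtype_apply, coe_restrict]
  rw [← map_add, hG, h.projSource_coe]

/-- Two decompositions of the same operator satisfy `N₂ × N₁' ≃ N₁ × N₂'`. -/
theorem nonempty_prod_equiv (h : Diagonalizes F M₁ N₁ M₂ N₂)
    (h' : Diagonalizes F M₁' N₁' M₂' N₂') [Module.Projective Aᵐᵒᵖ N₂'] :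
    Nonempty ((N₂ × N₁') ≃ₗ[Aᵐᵒᵖ] (N₁ × N₂')) := by
  -- `i` and `q` form the mapping cone of the map, induced by the projections of `h'`, from the
  -- complex `N₁ → N₂` to the complex `N₁' → N₂'`.
  let i : N₁ →ₗ[Aᵐᵒᵖ] N₂ × N₁' := h.restrict.prod (h'.projSource ∘ₗ N₁.subtype)
  let q : N₂ × N₁' →ₗ[Aᵐᵒᵖ] N₂' := (h'.projTarget ∘ₗ N₂.subtype).coprod (-h'.restrict)
  have hi : Function.Injective i := by
    refine (injective_iff_map_eq_zero i).2 fun x hx => ?_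
    have h1 : F.1 x = 0 := congrArg Subtype.val (congrArg Prod.fst hx)
    have h2 : h'.projSource x = 0 := congrArg Prod.snd hx
    exact Subtype.ext (h'.eq_zero_of_map_mem (h'.projSource_eq_zero_iff.1 h2)
      (h1 ▸ N₂'.zero_mem))
  have hiq : Function.Exact i q := by
    rintro ⟨y, z⟩
    constructor
    · intro hyz
      have hyz' : h'.projTarget (y : StdModule A) = h'.restrict z :=
        sub_eq_zero.1 ((sub_eq_add_neg _ _).trans hyz)
      have h1 : (y : StdModule A) - F.1 z ∈ M₂' := by
        rw [← h'.projTarget_eq_zero_iff, map_sub, hyz', ← h'.coe_restrict, h'.projTarget_coe,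
          sub_self]
      -- Correcting `z` by an element `m` of `M₁'` leaves its `N₁'`-component unchanged and makes
      -- its image exactly `y`.
      obtain ⟨m, hm, hFm⟩ := h'.bijOn.surjOn h1
      have hw : F.1 (m + z) = y := by rw [map_add, hFm, sub_add_cancel]
      refine ⟨⟨m + z, h.mem_of_map_mem (hw ▸ y.2)⟩, Prod.ext (Subtype.ext hw) ?_⟩
      change h'.projSource (m + z) = z
      rw [map_add, h'.projSource_eq_zero_iff.2 hm, zero_add, h'.projSource_coe]
    · rintro ⟨x, hx⟩
      rw [← hx]
      change h'.projTarget (F.1 x) + -h'.restrict (h'.projSource x) = 0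
      rw [h'.projTarget_map, add_neg_cancel]
  have hq : Function.Surjective q := fun v => by
    obtain ⟨m, -, y, hy, hv⟩ := h.exists_map_add v
    refine ⟨(⟨y, hy⟩, -h'.projSource m), ?_⟩
    change h'.projTarget y + -h'.restrict (-h'.projSource m) = v
    rw [map_neg, neg_neg, ← h'.projTarget_map, add_comm, ← map_add, hv, h'.projTarget_coe]
  -- Projectivity of `N₂'` splits the sequence.
  obtain ⟨l, hl⟩ := Module.projective_lifting_property q LinearMap.id hq
  obtain ⟨e, -⟩ := ((Function.Exact.split_tfae' hiq).out 0 2 rfl rfl).1 ⟨hi, l, hl⟩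
  exact ⟨e⟩

/-! ### Stability under small perturbations. -/

/-- Operators close to `F` have decompositions with complements isomorphic to those of `F`. -/
theorem eventually_nhds (h : Diagonalizes F M₁ N₁ M₂ N₂) :
    ∀ᶠ G in nhds F, ∃ N₁' M₂', Diagonalizes G M₁ N₁' M₂' N₂ ∧
      Nonempty (N₁ ≃ₗ[Aᵐᵒᵖ] N₁') := by
  have : CompleteSpace (M₁.restrictScalars ℂ) := h.isClosed_M₁.completeSpace_coe
  have : CompleteSpace (M₂.restrictScalars ℂ) := h.isClosed_M₂.completeSpace_coe
  let P : StdModule A →L[ℂ] M₂.restrictScalars ℂ :=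
    Submodule.projectionOntoL (M₂.restrictScalars ℂ) (N₂.restrictScalars ℂ)
      (Submodule.IsCompl.isTopCompl_of_isClosed (isCompl_restrictScalars h.isCompl₂)
        h.isClosed_M₂ h.isClosed_N₂)
  have hPM : ∀ y : M₂.restrictScalars ℂ, P y = y := fun y =>
    Submodule.projectionOnto_apply_left (isCompl_restrictScalars h.isCompl₂) y
  have hP0 : ∀ y, P y = 0 ↔ y ∈ N₂ := fun y =>
    Submodule.projectionOnto_apply_eq_zero_iff (isCompl_restrictScalars h.isCompl₂)
  -- `C G` is the `M₁ → M₂` corner of `G`. It depends continuously on `G` and is invertible at `F`,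
  -- hence near `F`, since invertible operators between Banach spaces form an open set.
  let C : AdjointableOperators A → (M₁.restrictScalars ℂ →L[ℂ] M₂.restrictScalars ℂ) :=
    fun G => P ∘L G.1 ∘L (M₁.restrictScalars ℂ).subtypeL
  have hC : Continuous C :=
    continuous_const.clm_comp (continuous_subtype_val.clm_comp continuous_const)
  have hCF : Function.Bijective (C F) := by
    have : (C F : M₁ → M₂) = h.bijOn.mapsTo.restrict _ _ _ :=
      funext fun x => hPM ⟨F.1 x, h.bijOn.mapsTo x.2⟩
    exact this ▸ h.bijOn.bijective
  let e := ContinuousLinearEquiv.ofBijective (C F) (LinearMap.ker_eq_bot.2 hCF.1)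
    (LinearMap.range_eq_top.2 hCF.2)
  have he : (e : M₁.restrictScalars ℂ →L[ℂ] M₂.restrictScalars ℂ) = C F :=
    ContinuousLinearEquiv.coe_ofBijective _ _ _
  have hev : ∀ᶠ G in nhds F, C G ∈ Set.range
      ((↑) : (M₁.restrictScalars ℂ ≃L[ℂ] M₂.restrictScalars ℂ) → _) :=
    hC.continuousAt.eventually (he ▸ ContinuousLinearEquiv.nhds e)
  filter_upwards [hev] with G ⟨T, hT⟩
  have hT' : ∀ m : M₁.restrictScalars ℂ, T m = P (G.1 m) := fun m => DFunLike.congr_fun hT m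
  have hinj : ∀ m ∈ M₁, G.1 m ∈ N₂ → m = 0 := fun m hm hGm => by
    have h0 : T ⟨m, hm⟩ = 0 := (hT' ⟨m, hm⟩).trans ((hP0 _).2 hGm)
    exact congrArg Subtype.val ((map_eq_zero_iff T T.injective).1 h0)
  have hsurj : ∀ y, ∃ m ∈ M₁, y - G.1 m ∈ N₂ := fun y => by
    refine ⟨T.symm (P y), (T.symm (P y)).2, ?_⟩
    rw [← hP0, map_sub, ← hT', T.apply_symm_apply, sub_self]
  -- Keeping `M₁` and `N₂` forces the other two summands to be `G⁻¹(N₂)` and `G(M₁)`.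
  have hcompl₁ : IsCompl M₁ (N₂.comap (AdjointableOperators.toLinearMap G)) := by
    refine ⟨Submodule.disjoint_def.2 hinj, codisjoint_iff.2 (eq_top_iff.2 fun x _ => ?_)⟩
    obtain ⟨m, hm, hxm⟩ := hsurj (G.1 x)
    rw [← add_sub_cancel m x]
    refine Submodule.add_mem_sup hm ?_
    rwa [← map_sub] at hxm
  refine ⟨N₂.comap (AdjointableOperators.toLinearMap G), M₁.map (AdjointableOperators.toLinearMap G), ⟨h.isClosed_M₁,
    h.isClosed_N₂.preimage G.1.continuous, ?_, h.isClosed_N₂, hcompl₁, ?_, ?_, fun _ hx => hx⟩,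
    -- Both complements of `M₁` are isomorphic to the quotient by `M₁`.
    ⟨(Submodule.quotientEquivOfIsCompl M₁ N₁ h.isCompl₁).symm.trans
      (Submodule.quotientEquivOfIsCompl M₁ _ hcompl₁)⟩⟩
  -- `G(M₁)` is closed as the fixed-point set of the continuous map `G ∘ T⁻¹ ∘ P`.
  · have : ((M₁.map (AdjointableOperators.toLinearMap G) : Submodule _ _) : Set (StdModule A)) =
        {y | G.1 (T.symm (P y)) = y} := by
      refine Set.Subset.antisymm ?_ fun y hy => ⟨_, (T.symm (P y)).2, hy⟩
      rintro _ ⟨m, hm, rfl⟩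
      change G.1 (T.symm (P (G.1 m))) = G.1 m
      rw [show P (G.1 m) = T ⟨m, hm⟩ from (hT' ⟨m, hm⟩).symm, T.symm_apply_apply]
    rw [this]
    exact isClosed_eq (G.1.continuous.comp
      (continuous_subtype_val.comp (T.symm.continuous.comp P.continuous))) continuous_id
  · refine ⟨Submodule.disjoint_def.2 ?_, codisjoint_iff.2 (eq_top_iff.2 fun y _ => ?_)⟩
    · rintro _ ⟨m, hm, rfl⟩ hGm
      rw [hinj m hm hGm, map_zero]
    · obtain ⟨m, hm, hym⟩ := hsurj y
      rw [← add_sub_cancel (G.1 m) y]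
      exact Submodule.add_mem_sup ⟨m, hm, rfl⟩ hym
  · refine ⟨fun m hm => ⟨m, hm, rfl⟩, fun m hm m' hm' hmm => ?_, fun _ hy => hy⟩
    refine sub_eq_zero.1 (hinj _ (M₁.sub_mem hm hm') ?_)
    rw [map_sub, sub_eq_zero.2 hmm]
    exact N₂.zero_mem

end Diagonalizes

end Decompositions

/-! ### Classes in `K(A)` and the index. -/

section Classes

variable {A : Type u} [CStarAlgebra A]

theorem KGroup.cls_congr {P Q : Type u} [AddCommGroup P] [Module Aᵐᵒᵖ P] [Module.Finite Aᵐᵒᵖ P]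
    [Module.Projective Aᵐᵒᵖ P] [AddCommGroup Q] [Module Aᵐᵒᵖ Q] [Module.Finite Aᵐᵒᵖ Q]
    [Module.Projective Aᵐᵒᵖ Q] (e : P ≃ₗ[Aᵐᵒᵖ] Q) : KGroup.cls A P = KGroup.cls A Q :=
  congrArg Algebra.GrothendieckAddGroup.of (Quotient.sound ⟨e⟩)

theorem KGroup.cls_prod (P Q : Type u) [AddCommGroup P] [Module Aᵐᵒᵖ P] [Module.Finite Aᵐᵒᵖ P]
    [Module.Projective Aᵐᵒᵖ P] [AddCommGroup Q] [Module Aᵐᵒᵖ Q] [Module.Finite Aᵐᵒᵖ Q]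
    [Module.Projective Aᵐᵒᵖ Q] :
    KGroup.cls A (P × Q) = KGroup.cls A P + KGroup.cls A Q :=
  let p : FGProjectiveClass Aᵐᵒᵖ := Quotient.mk _ ⟨P⟩
  let q : FGProjectiveClass Aᵐᵒᵖ := Quotient.mk _ ⟨Q⟩
  map_add Algebra.GrothendieckAddGroup.of p q

namespace MPhiDecomposition

variable {F G : AdjointableOperators A}

instance (d : MPhiDecomposition F) : Module.Finite Aᵐᵒᵖ d.N₁ := Module.Finite.iff_fg.2 d.fg₁

instance (d : MPhiDecomposition F) : Module.Finite Aᵐᵒᵖ d.N₂ := Module.Finite.iff_fg.2 d.fg₂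

instance (d : MPhiDecomposition F) : Module.Projective Aᵐᵒᵖ d.N₁ :=
  projective_of_isCompl d.diagonalizes.isClosed_M₁ d.diagonalizes.isClosed_N₁
    d.diagonalizes.isCompl₁ d.fg₁

instance (d : MPhiDecomposition F) : Module.Projective Aᵐᵒᵖ d.N₂ :=
  projective_of_isCompl d.diagonalizes.isClosed_M₂ d.diagonalizes.isClosed_N₂
    d.diagonalizes.isCompl₂ d.fg₂

theorem index_def (d : MPhiDecomposition F) :
    d.index = KGroup.cls A d.N₁ - KGroup.cls A d.N₂ := rfl

/-- The index does not depend on the decomposition. -/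
theorem index_eq (d d' : MPhiDecomposition F) : d.index = d'.index := by
  obtain ⟨e⟩ := d.diagonalizes.nonempty_prod_equiv d'.diagonalizes
  have := KGroup.cls_congr e
  rw [KGroup.cls_prod, KGroup.cls_prod] at this
  rw [index_def, index_def, sub_eq_sub_iff_add_eq_add, ← this, add_comm]

theorem index_eq_of_equiv (d : MPhiDecomposition F) (d' : MPhiDecomposition G)
    (e₁ : d.N₁ ≃ₗ[Aᵐᵒᵖ] d'.N₁) (e₂ : d.N₂ ≃ₗ[Aᵐᵒᵖ] d'.N₂) : d.index = d'.index := by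
  rw [index_def, index_def, KGroup.cls_congr e₁, KGroup.cls_congr e₂]

/-- The index is locally constant. -/
theorem eventually_index_eq (d : MPhiDecomposition F) :
    ∀ᶠ G in nhds F, ∃ d' : MPhiDecomposition G, d'.index = d.index := by
  filter_upwards [d.diagonalizes.eventually_nhds] with G ⟨N₁', M₂', h, ⟨e⟩⟩
  have hfg : N₁'.FG := Module.Finite.iff_fg.1 (Module.Finite.equiv e)
  let d' : MPhiDecomposition G := ⟨_, _, _, _, h, hfg, d.fg₂⟩
  exact ⟨d', (index_eq_of_equiv d d' e (LinearEquiv.refl _ _)).symm⟩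

end MPhiDecomposition

/-! ### Openness and disjointness of the three classes of operators. -/

variable (A)

theorem isOpen_MPhi : IsOpen (MPhi A) := by
  refine isOpen_iff_eventually.2 fun F hF => ?_
  obtain ⟨d⟩ := mem_MPhi_iff.1 hF
  filter_upwards [d.eventually_index_eq] with G ⟨d', _⟩
  exact mem_MPhi_iff.2 ⟨d'⟩

/-- The nearby decomposition has the same `N₂`. If `G` were in `MPhi A`, then `fg_target` would make
this `N₂` finitely generated and put `F` in `MPhi A`. -/
theorem isOpen_MPhiPlus_diff_MPhi : IsOpen (MPhiPlus A \ MPhi A) := by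
  refine isOpen_iff_eventually.2 ?_
  rintro F ⟨⟨M₁, N₁, M₂, N₂, h, hfg⟩, hF⟩
  filter_upwards [h.eventually_nhds] with G ⟨N₁', M₂', h', ⟨e⟩⟩
  have := Module.Finite.iff_fg.2 hfg
  have hfg' : N₁'.FG := Module.Finite.iff_fg.1 (Module.Finite.equiv e)
  refine ⟨⟨_, _, _, _, h', hfg'⟩, ?_⟩
  rintro ⟨_, _, _, _, h'', -, h₂⟩
  exact hF ⟨_, _, _, _, h, hfg, h'.fg_target h'' hfg' h₂⟩

/-- Here `fg_source` makes `N₁'` finitely generated if `G` is in `MPhi A`, and the isomorphism with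
`N₁` carries this back to `F`. -/
theorem isOpen_MPhiMinus_diff_MPhi : IsOpen (MPhiMinus A \ MPhi A) := by
  refine isOpen_iff_eventually.2 ?_
  rintro F ⟨⟨M₁, N₁, M₂, N₂, h, hfg⟩, hF⟩
  filter_upwards [h.eventually_nhds] with G ⟨N₁', M₂', h', ⟨e⟩⟩
  refine ⟨⟨_, _, _, _, h', hfg⟩, ?_⟩
  rintro ⟨_, _, _, _, h'', h₁, -⟩
  have := Module.Finite.iff_fg.2 (h'.fg_source h'' h₁ hfg)
  exact hF ⟨_, _, _, _, h, Module.Finite.iff_fg.1 (Module.Finite.equiv e.symm), hfg⟩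

theorem MPhiPlus_inter_MPhiMinus_subset : MPhiPlus A ∩ MPhiMinus A ⊆ MPhi A := by
  rintro F ⟨⟨_, _, _, _, h, h₁⟩, ⟨_, _, _, _, h', h₂⟩⟩
  exact ⟨_, _, _, _, h, h₁, h.fg_target h' h₁ h₂⟩

variable {A}

/-- A connected family of operators which is covered by two disjoint open sets stays in the one it meets. -/
theorem forall_mem_of_mem {X : Type*} [TopologicalSpace X] [PreconnectedSpace X]
    {f : X → AdjointableOperators A} (hf : Continuous f) {S T : Set (AdjointableOperators A)}
    (hS : IsOpen S) (hT : IsOpen T) (hST : Disjoint S T) (hcov : ∀ t, f t ∈ S ∪ T) {a : X}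
    (ha : f a ∈ S) (t : X) : f t ∈ S := by
  have hcompl : (f ⁻¹' S)ᶜ = f ⁻¹' T := by
    ext s
    exact ⟨(hcov s).resolve_left, fun hs hs' => Set.disjoint_left.1 hST hs' hs⟩
  have hclopen : IsClopen (f ⁻¹' S) :=
    ⟨isOpen_compl_iff.1 (hcompl ▸ hT.preimage hf), hS.preimage hf⟩
  exact Set.eq_univ_iff_forall.1 (hclopen.eq_univ ⟨a, ha⟩) t

end Classes

/-! ### Connectedness of the unit interval. -/

theorem corollary4p3 {A : Type u} [CStarAlgebra A] (f : unitInterval → AdjointableOperators A)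
    (hf : Continuous f) (hsemi : ∀ t, f t ∈ MPhiPlus A ∪ MPhiMinus A) :
    (f 0 ∈ MPhiPlus A \ MPhi A → f 1 ∈ MPhiPlus A \ MPhi A) ∧
    (f 0 ∈ MPhiMinus A \ MPhi A → f 1 ∈ MPhiMinus A \ MPhi A) ∧
    (f 0 ∈ MPhi A → f 1 ∈ MPhi A ∧
      ∀ (d₀ : MPhiDecomposition (f 0)) (d₁ : MPhiDecomposition (f 1)), d₀.index = d₁.index) := by
  have hP := isOpen_MPhiPlus_diff_MPhi A
  have hM := isOpen_MPhiMinus_diff_MPhi A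
  have hF := isOpen_MPhi A
  have hPM : ∀ G ∈ MPhiPlus A, G ∈ MPhiMinus A → G ∈ MPhi A := fun G h h' =>
    MPhiPlus_inter_MPhiMinus_subset A ⟨h, h'⟩
  refine ⟨fun h => forall_mem_of_mem hf hP (hM.union hF) ?_ (fun t => ?_) h 1,
    fun h => forall_mem_of_mem hf hM (hP.union hF) ?_ (fun t => ?_) h 1, fun h => ?_⟩
  · refine Set.disjoint_left.2 fun G hG hG' => ?_
    exact hG'.elim (fun hG' => hG.2 (hPM G hG.1 hG'.1)) hG.2
  · have := hsemi t
    simp only [Set.mem_union, Set.mem_sdiff] at this ⊢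
    tauto
  · refine Set.disjoint_left.2 fun G hG hG' => ?_
    exact hG'.elim (fun hG' => hG.2 (hPM G hG'.1 hG.1)) hG.2
  · have := hsemi t
    simp only [Set.mem_union, Set.mem_sdiff] at this ⊢
    tauto
  · have hall : ∀ t, f t ∈ MPhi A := forall_mem_of_mem hf hF (hP.union hM)
      (Set.disjoint_left.2 fun G hG hG' => hG'.elim (fun h => h.2 hG) (fun h => h.2 hG))
      (fun t => by
        have := hsemi t
        simp only [Set.mem_union, Set.mem_sdiff] at this ⊢
        tauto) h
    refine ⟨hall 1, fun d₀ d₁ => ?_⟩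
    -- The choice need not be continuous in `t`: by `index_eq` the index does not see it.
    let d (t : unitInterval) : MPhiDecomposition (f t) := (mem_MPhi_iff.1 (hall t)).some
    have hloc : IsLocallyConstant fun t => (d t).index := by
      refine (IsLocallyConstant.iff_eventually_eq _).2 fun t => ?_
      filter_upwards [hf.continuousAt.eventually (d t).eventually_index_eq] with s ⟨d', hd'⟩
      rw [← hd', (d s).index_eq d']
    rw [d₀.index_eq (d 0), d₁.index_eq (d 1)]
    exact hloc.apply_eq_of_preconnectedSpace 0 1
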